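/- Let $n,d,k$ be integers with $d\ge 2$ and $1\le k<n$. Let $G$ be a $k$-network on $n$ nodes, i.e. a hypergraph with node set $\{1,\dots,n\}$ all of whose hyperedges (sources) have at most $k$ elements. A $G$ state is a tensor product $\bigotimes_{e}\gamma_e$ over the hyperedges, where $\gamma_e$ is a quantum state of any finite dimension shared by the nodes $v\in e$. Let $\mathcal S_{\mathrm C}(G)$ be the closure of the set of states on $(\mathbb C^d)^{\otimes n}$ (one factor $\mathbb C^d$ at each node) that can be prepared from $G$ states by local operations and shared randomness (LOSR), i.e. by maps $\sum_\lambda p_\lambda \bigotimes_{v} C_v^{(\lambda)}$ with $(p_\lambda)$ a finite probability distribution and $C_v^{(\lambda)}$ a quantum channel from the system held by node $v$ to $\mathbb C^d$. For a state $\rho$ on $(\mathbb C^d)^{\otimes n}$ the network-entanglement weight is $$\mathcal E_w(\rho)=\min\{p\in\mathbb R : \rho\succeq(1-p)\sigma \text{ for some } \sigma\in\mathcal S_{\mathrm C}(G)\}.$$ Let $\mathrm{GHZ}=\frac1d\sum_{i,j=0}^{d-1}(|i\rangle\langle j|)^{\otimes n}$, $W_k=k\,\mathbb 1-(k+1)\,\mathrm{GHZ}$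 and $w_k(\rho)=\max\{0,-\operatorname{tr}(W_k\rho)\}$. Then $$\mathcal E_w(\rho)\ \ge\ w_k(\rho)\qquad\text{for every state }\rho\text{ on }(\mathbb C^d)^{\otimes n}.$$ The bound is tight for the GHZ state: $\mathcal E_w(\mathrm{GHZ})=w_k(\mathrm{GHZ})=1$. -/

import Mathlib

open scoped Matrix ComplexOrder

namespace QNet

/-- A quantum state on the finite-dimensional Hilbert space with orthonormal basis `ι`:
a positive semidefinite matrix of trace one. -/
structure IsState {ι : Type*} [Fintype ι] (ρ : Matrix ι ι ℂ) : Prop where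
  posSemidef : ρ.PosSemidef
  trace_eq_one : ρ.trace = 1

/-- The tensor product of a finite family of (rectangular) matrices. -/
def tensor {V : Type*} [Fintype V] {α β : V → Type*}
    (M : ∀ v, Matrix (β v) (α v) ℂ) : Matrix (∀ v, β v) (∀ v, α v) ℂ :=
  Matrix.of fun b a => ∏ v, M v (b v) (a v)

/-- A quantum channel (completely positive trace-preserving map) between finite-dimensional
systems with bases `α` and `β`, given by finitely many Kraus operators `K j`, with
`∑ j, (K j)ᴴ * K j = 1`. -/
structure Channel (α β : Type*) [Fintype α] [DecidableEq α] [Fintype β] where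
  rank : ℕ
  kraus : Fin rank → Matrix β α ℂ
  trace_preserving : ∑ j, (kraus j)ᴴ * kraus j = 1

/-- The action of the tensor product `⨂ v, C v` of local channels on an operator on
`⨂ v, ℂ^(α v)`: its Kraus operators are the tensor products of the local ones. -/
noncomputable def applyLocal {V : Type*} [Fintype V] [DecidableEq V] {α β : V → Type*}
    [∀ v, Fintype (α v)] [∀ v, DecidableEq (α v)] [∀ v, Fintype (β v)]
    (C : ∀ v, Channel (α v) (β v)) (τ : Matrix (∀ v, α v) (∀ v, α v) ℂ) :
    Matrix (∀ v, β v) (∀ v, β v) ℂ :=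
  ∑ j : (∀ v, Fin (C v).rank),
    tensor (fun v => (C v).kraus (j v)) * τ * (tensor (fun v => (C v).kraus (j v)))ᴴ

/-- An operation by local operations and shared randomness (LOSR): a random variable `l` with
distribution `prob` is shared by all the nodes, and given `l` node `v` applies the channel
`chan l v` to its own system. -/
structure LOSR {V : Type*} (α β : V → Type*)
    [∀ v, Fintype (α v)] [∀ v, DecidableEq (α v)] [∀ v, Fintype (β v)] where
  size : ℕ
  prob : Fin size → ℝ
  prob_nonneg : ∀ l, 0 ≤ prob l
  prob_sum : ∑ l, prob l = 1
  chan : Fin size → ∀ v, Channel (α v) (β v)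

/-- The action `τ ↦ ∑ l, prob l • (⨂ v, chan l v) τ` of an LOSR operation. -/
noncomputable def LOSR.apply {V : Type*} [Fintype V] [DecidableEq V] {α β : V → Type*}
    [∀ v, Fintype (α v)] [∀ v, DecidableEq (α v)] [∀ v, Fintype (β v)]
    (Λ : LOSR α β) (τ : Matrix (∀ v, α v) (∀ v, α v) ℂ) :
    Matrix (∀ v, β v) (∀ v, β v) ℂ :=
  ∑ l, (Λ.prob l : ℂ) • applyLocal (Λ.chan l) τ

/-- A quantum network: a hypergraph on the set `V` of nodes.  Each hyperedge stands for a source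
that distributes a joint quantum state to the nodes that it contains. -/
structure Network (V : Type*) where
  edges : Finset (Finset V)

namespace Network

/-- A `k`-network: every source is at most `k`-partite. -/
def IsKNetwork {V : Type*} (G : Network V) (k : ℕ) : Prop :=
  ∀ e ∈ G.edges, e.card ≤ k

/-- The basis of the joint system emitted by the source `e`, which sends a system of dimension
`D e v` to each of its nodes `v`. -/
abbrev SourceIdx {V : Type*} (G : Network V) (D : Finset V → V → ℕ) (e : G.edges) : Type _ :=
  ∀ v : e.1, Fin (D e.1 v.1)

/-- The basis of the system held by the node `v`: one subsystem from each source containing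
`v`. -/
abbrev NodeIdx {V : Type*} (G : Network V) (D : Finset V → V → ℕ) (v : V) : Type _ :=
  ∀ e : {e : G.edges // v ∈ e.1}, Fin (D e.1.1 v)

/-- The operator `⨂ e, γ e` on the tensor product of all the systems emitted by the sources, with
these systems grouped by the nodes that hold them. Since a pair (source, node of that source)
is the same as a pair (node, source at that node), a basis label `a` grouped by nodes restricts
to the label `fun v => a v e` of the source `e`. -/
def sourceProduct {V : Type*} (G : Network V) (D : Finset V → V → ℕ)
    (γ : ∀ e : G.edges, Matrix (G.SourceIdx D e) (G.SourceIdx D e) ℂ) :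
    Matrix (∀ v, G.NodeIdx D v) (∀ v, G.NodeIdx D v) ℂ :=
  Matrix.of fun a b => ∏ e : G.edges,
    γ e (fun v => a v.1 ⟨e, v.2⟩) (fun v => b v.1 ⟨e, v.2⟩)

/-- The states, with local system `β v` at node `v`, that can be prepared exactly by LOSR from a
`G` state, that is, from a tensor product of source states of any finite dimensions. -/
def preparable {V : Type*} [Fintype V] [DecidableEq V] (G : Network V) (β : V → Type*)
    [∀ v, Fintype (β v)] : Set (Matrix (∀ v, β v) (∀ v, β v) ℂ) :=
  {σ | ∃ (D : Finset V → V → ℕ)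
      (γ : ∀ e : G.edges, Matrix (G.SourceIdx D e) (G.SourceIdx D e) ℂ)
      (Λ : LOSR (G.NodeIdx D) β),
      (∀ e, IsState (γ e)) ∧ σ = Λ.apply (G.sourceProduct D γ)}

/-- The set `S_C(G)`: the closure of the set of states that can be prepared by LOSR from
`G` states. -/
def freeStates {V : Type*} [Fintype V] [DecidableEq V] (G : Network V) (β : V → Type*)
    [∀ v, Fintype (β v)] : Set (Matrix (∀ v, β v) (∀ v, β v) ℂ) :=
  closure (G.preparable β)

/-- The network-entanglement weight `E_w(ρ | G)`: the minimal `p` such that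
`ρ ⪰ (1 - p) σ` for some `σ ∈ S_C(G)`. -/
noncomputable def weight {V : Type*} [Fintype V] [DecidableEq V] (G : Network V) {β : V → Type*}
    [∀ v, Fintype (β v)] (ρ : Matrix (∀ v, β v) (∀ v, β v) ℂ) : ℝ :=
  sInf {p : ℝ | ∃ σ ∈ G.freeStates β, (ρ - ((1 - p : ℝ) : ℂ) • σ).PosSemidef}

end Network

/-- The GHZ state `(1/d) ∑ i j, (|i⟩⟨j|)^{⊗ n}` of `n` systems of dimension `d`. -/
noncomputable def ghz (n d : ℕ) : Matrix (Fin n → Fin d) (Fin n → Fin d) ℂ :=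
  (1 / (d : ℂ)) • ∑ i : Fin d, ∑ j : Fin d, tensor (fun _ : Fin n => Matrix.single i j (1 : ℂ))

/-- The witness operator `W_k = k 𝟙 - (k + 1) GHZ`. -/
noncomputable def witness (n d k : ℕ) : Matrix (Fin n → Fin d) (Fin n → Fin d) ℂ :=
  (k : ℂ) • (1 : Matrix (Fin n → Fin d) (Fin n → Fin d) ℂ) - ((k : ℂ) + 1) • ghz n d

/-- `w_k(ρ) = max {0, - tr (W_k ρ)}` (the trace is real for Hermitian `ρ`). -/
noncomputable def witnessBound {n d : ℕ} (k : ℕ)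
    (ρ : Matrix (Fin n → Fin d) (Fin n → Fin d) ℂ) : ℝ :=
  max 0 (-(witness n d k * ρ).trace.re)

end QNet

namespace QNet

open Function

/-! ### Positivity and expectation values of local operators -/

/-! The core is a fidelity bound: a state `σ` prepared from a `k`-network has `tr (GHZ σ) ≤ k / (k +
1)`. If `ρ - (1 - p) σ` is positive, it has trace `p`, hence GHZ overlap at most `p`. For `p ≤ 1`
this gives `tr (GHZ ρ) ≤ p + (1 - p) k / (k + 1)`, which rearranges to `-tr (W_k ρ) ≤ p`. For GHZ
itself the bound equals 1, and `p = 1` is always feasible.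

For the fidelity, convexity removes the shared randomness. Positivity then bounds the overlap by `(∑
i, √P(i,…,i))² / d`, where `P` is the outcome distribution of measuring every node in the standard
basis, so a statement about classical correlations remains.

Fix `k + 1` nodes in some order `t 0, …, t k`. A source reaches at most `k` nodes, so it misses some
`t m`. Replacing its state by the product of its marginals on the nodes before `t m` and on all its
other nodes leaves the joint law of consecutive nodes unchanged but makes the two ends independent
(`exists_inflation`). In the new distribution either the ends agree or some consecutive pair
differs, so `1 ≤ P'(ends agree) + ∑ P'(neighbours differ)`, and every term is determined by one- and
two-node marginals of `P`.

Averaging over all orderings gives a quadratic inequality between the probabilities of unanimous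
outcomes and the statistics of the non-unanimous ones (`sq_sum_sqrt_le_of_chain`). Cauchy–Schwarz
estimates (`sq_sum_le_of_variance`, `le_of_sq_sub_le`) turn it into the fidelity bound for `k ≥ 2`.
For `k = 1` the two nodes are independent, and Cauchy–Schwarz suffices. -/

/-- The expectation value `tr (τ * ⨂ v, N v)`, as a multilinear function of the local operators. -/
noncomputable def expectation {V : Type*} [Fintype V] [DecidableEq V] {α : V → Type*}
    [∀ v, Fintype (α v)] (τ : Matrix (∀ v, α v) (∀ v, α v) ℂ) :
    MultilinearMap ℂ (fun v => Matrix (α v) (α v) ℂ) ℂ :=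
  ∑ x, ∑ y, τ x y • (MultilinearMap.mkPiAlgebra ℂ V ℂ).compLinearMap
    (fun v => Matrix.entryLinearMap ℂ ℂ (y v) (x v))

open scoped MatrixOrder Matrix.Norms.L2Operator in
theorem exists_eq_conjTranspose_mul_self {ι : Type*} [Fintype ι] {A : Matrix ι ι ℂ}
    (hA : A.PosSemidef) : ∃ B : Matrix ι ι ℂ, A = Bᴴ * B := by
  classical
  exact CStarAlgebra.nonneg_iff_eq_star_mul_self.mp hA.nonneg

theorem prod_one_apply {V : Type*} [Fintype V] {α : V → Type*} [∀ v, DecidableEq (α v)]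
    [DecidableEq (∀ v, α v)] (x y : ∀ v, α v) :
    ∏ v, (1 : Matrix (α v) (α v) ℂ) (y v) (x v) = if x = y then 1 else 0 := by
  simp only [Matrix.one_apply]
  by_cases h : x = y
  · subst h; simp
  · obtain ⟨v, hv⟩ := Function.ne_iff.1 h
    rw [if_neg h]
    exact Finset.prod_eq_zero (Finset.mem_univ v) (if_neg (Ne.symm hv))

section Expectation

variable {V : Type*} [Fintype V] [DecidableEq V] {α : V → Type*} [∀ v, Fintype (α v)]

theorem expectation_apply (τ : Matrix (∀ v, α v) (∀ v, α v) ℂ)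
    (N : ∀ v, Matrix (α v) (α v) ℂ) :
    expectation τ N = ∑ x, ∑ y, τ x y * ∏ v, N v (y v) (x v) := by
  simp [expectation]

/-- The product of the two marginals of `γ` on the subsystems in `L` and on the others. -/
noncomputable def splitState (L : V → Prop) [DecidablePred L]
    (γ : Matrix (∀ v, α v) (∀ v, α v) ℂ) : Matrix (∀ v, α v) (∀ v, α v) ℂ :=
  ∑ c : ∀ v, α v, Matrix.of fun a b =>
    γ (fun v => if L v then a v else c v) (fun v => if L v then b v else c v) *
      γ (fun v => if L v then c v else a v) (fun v => if L v then c v else b v)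

/-- For fixed `c` the summand is the submatrix of `γ ⊗ γ` along `a ↦ (a on L and c off L, c on L and
a off L)`. One label `c` serves both partial traces, since they run over complementary subsystems.
-/
theorem splitState_posSemidef (L : V → Prop) [DecidablePred L]
    {γ : Matrix (∀ v, α v) (∀ v, α v) ℂ} (hγ : γ.PosSemidef) : (splitState L γ).PosSemidef := by
  refine Matrix.posSemidef_sum _ fun c _ => ?_
  exact (hγ.kronecker hγ).submatrix
    fun a : ∀ v, α v => ((fun v => if L v then a v else c v : ∀ v, α v),
      (fun v => if L v then c v else a v : ∀ v, α v))

variable [∀ v, DecidableEq (α v)]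

theorem expectation_one (τ : Matrix (∀ v, α v) (∀ v, α v) ℂ) :
    expectation τ (fun _ => 1) = τ.trace := by
  simp only [expectation_apply, prod_one_apply]
  simp [Matrix.trace]

theorem expectation_update (τ : Matrix (∀ v, α v) (∀ v, α v) ℂ)
    (N : ∀ v, Matrix (α v) (α v) ℂ) (u : V) (A : Matrix (α u) (α u) ℂ) :
    expectation τ (update N u A) =
      ∑ s, ∑ t, A s t * expectation τ (update N u (Matrix.single s t 1)) := by
  conv_lhs => rw [Matrix.matrix_eq_sum_single A]
  rw [MultilinearMap.map_update_sum]
  refine Finset.sum_congr rfl fun s _ => ?_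
  rw [MultilinearMap.map_update_sum]
  refine Finset.sum_congr rfl fun t _ => ?_
  rw [← smul_eq_mul, ← MultilinearMap.map_update_smul]
  simp

/-- Exchanging the components outside `L` of two labels. -/
def mixEquiv (L : V → Prop) [DecidablePred L] :
    (∀ v, α v) × (∀ v, α v) ≃ (∀ v, α v) × (∀ v, α v) where
  toFun p := (fun v => if L v then p.1 v else p.2 v, fun v => if L v then p.2 v else p.1 v)
  invFun p := (fun v => if L v then p.1 v else p.2 v, fun v => if L v then p.2 v else p.1 v)
  left_inv p := by ext v <;> by_cases h : L v <;> simp [h]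
  right_inv p := by ext v <;> by_cases h : L v <;> simp [h]

/-- On two independent copies of `γ`, exchanging the components outside `L` gathers all the
nontrivial operators on one copy of the labels. The identities on the other copy force its row and
column labels to coincide, which is the sum over `c`. -/
theorem expectation_splitState (L : V → Prop) [DecidablePred L]
    (γ : Matrix (∀ v, α v) (∀ v, α v) ℂ) (N : ∀ v, Matrix (α v) (α v) ℂ) :
    expectation (splitState L γ) N =
      expectation γ (fun v => if L v then N v else 1) *
        expectation γ (fun v => if L v then 1 else N v) := by
  have key : ∀ x y c c' : ∀ v, α v,
      (∏ v, (if L v then N v else 1) (if L v then y v else c' v) (if L v then x v else c v)) *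
      (∏ v, (if L v then 1 else N v) (if L v then c' v else y v) (if L v then c v else x v))
      = (∏ v, N v (y v) (x v)) * if c = c' then 1 else 0 := by
    intro x y c c'
    rw [← prod_one_apply, ← Finset.prod_mul_distrib, ← Finset.prod_mul_distrib]
    refine Finset.prod_congr rfl fun v _ => ?_
    by_cases h : L v
    · simp only [if_pos h]
    · simp only [if_neg h]; rw [mul_comm]
  have hR : expectation γ (fun v => if L v then N v else 1) *
        expectation γ (fun v => if L v then 1 else N v) =
      ∑ p : (∀ v, α v) × (∀ v, α v), ∑ q : (∀ v, α v) × (∀ v, α v),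
        (γ p.1 q.1 * γ p.2 q.2) *
        ((∏ v, (if L v then N v else 1) (q.1 v) (p.1 v)) *
        (∏ v, (if L v then 1 else N v) (q.2 v) (p.2 v))) := by
    rw [expectation_apply, expectation_apply, Finset.sum_mul_sum, Fintype.sum_prod_type]
    refine Finset.sum_congr rfl fun x _ => Finset.sum_congr rfl fun x' _ => ?_
    rw [Finset.sum_mul_sum, Fintype.sum_prod_type]
    refine Finset.sum_congr rfl fun y _ => Finset.sum_congr rfl fun y' _ => ?_
    ring
  rw [hR, ← (mixEquiv L).sum_comp,
    Finset.sum_congr rfl fun p _ => ((mixEquiv (α := α) L).sum_comp _).symm]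
  simp only [mixEquiv, Equiv.coe_fn_mk, key]
  simp only [Fintype.sum_prod_type, mul_ite, mul_one, mul_zero, Finset.sum_ite_eq,
    Finset.mem_univ, if_true]
  rw [expectation_apply]
  refine Finset.sum_congr rfl fun x _ => ?_
  rw [Finset.sum_comm]
  refine Finset.sum_congr rfl fun y _ => ?_
  simp [splitState, Matrix.sum_apply, Finset.sum_mul]

theorem splitState_isState (L : V → Prop) [DecidablePred L]
    {γ : Matrix (∀ v, α v) (∀ v, α v) ℂ} (hγ : IsState γ) : IsState (splitState L γ) where
  posSemidef := splitState_posSemidef L hγ.posSemidef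
  trace_eq_one := by
    rw [← expectation_one, expectation_splitState]
    simp [expectation_one, hγ.trace_eq_one]

end Expectation

/-! ### Local measurements -/

/-- The operator measuring the function `f` of the outcome in the standard basis, after the
channel `C`. -/
noncomputable def Channel.effect {α β : Type*} [Fintype α] [DecidableEq α] [Fintype β]
    (C : Channel α β) (f : β → ℂ) : Matrix α α ℂ :=
  Matrix.of fun y x => ∑ b, f b * ∑ j, C.kraus j b x * star (C.kraus j b y)

theorem Channel.effect_one {α β : Type*} [Fintype α] [DecidableEq α] [Fintype β]
    (C : Channel α β) : C.effect (fun _ => 1) = 1 := by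
  rw [← C.trace_preserving]
  ext y x
  simp only [effect, Matrix.of_apply, one_mul, Matrix.sum_apply, Matrix.mul_apply,
    Matrix.conjTranspose_apply]
  rw [Finset.sum_comm]
  simp [mul_comm]

section Local

variable {V : Type*} [Fintype V] [DecidableEq V] {α β : V → Type*} [∀ v, Fintype (α v)]
  [∀ v, DecidableEq (α v)] [∀ v, Fintype (β v)]

theorem applyLocal_apply_self (C : ∀ v, Channel (α v) (β v))
    (τ : Matrix (∀ v, α v) (∀ v, α v) ℂ) (a : ∀ v, β v) :
    applyLocal C τ a a = ∑ x, ∑ y, τ x y *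
      ∏ v, ∑ j, (C v).kraus j (a v) (x v) * star ((C v).kraus j (a v) (y v)) := by
  simp only [applyLocal, Matrix.sum_apply, Matrix.mul_apply, Matrix.conjTranspose_apply, tensor,
    Matrix.of_apply, Finset.prod_univ_sum, Fintype.piFinset_univ, Finset.mul_sum, Finset.sum_mul]
  rw [Finset.sum_congr rfl fun j _ => Finset.sum_comm, Finset.sum_comm]
  refine Finset.sum_congr rfl fun x _ => ?_
  rw [Finset.sum_comm]
  refine Finset.sum_congr rfl fun y _ => Finset.sum_congr rfl fun j _ => ?_
  rw [Finset.prod_mul_distrib, star_prod]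
  ring

/-- Passage to the Heisenberg picture: a product observable diagonal in the output basis pulls back
to a product of operators on the input systems. -/
theorem sum_mul_applyLocal (C : ∀ v, Channel (α v) (β v))
    (τ : Matrix (∀ v, α v) (∀ v, α v) ℂ) (f : ∀ v, β v → ℂ) :
    ∑ a, (∏ v, f v (a v)) * applyLocal C τ a a =
      expectation τ (fun v => (C v).effect (f v)) := by
  simp only [applyLocal_apply_self, expectation_apply, Channel.effect, Matrix.of_apply,
    Finset.mul_sum]
  rw [Finset.sum_comm]
  refine Finset.sum_congr rfl fun x _ => ?_
  rw [Finset.sum_comm]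
  refine Finset.sum_congr rfl fun y _ => ?_
  rw [Finset.prod_univ_sum, Fintype.piFinset_univ, Finset.mul_sum]
  refine Finset.sum_congr rfl fun a _ => ?_
  simp only [← Finset.mul_sum]
  rw [Finset.prod_mul_distrib]; ring

theorem applyLocal_posSemidef (C : ∀ v, Channel (α v) (β v))
    {τ : Matrix (∀ v, α v) (∀ v, α v) ℂ} (hτ : τ.PosSemidef) : (applyLocal C τ).PosSemidef :=
  Matrix.posSemidef_sum _ fun _ _ => hτ.mul_mul_conjTranspose_same _

theorem applyLocal_trace (C : ∀ v, Channel (α v) (β v))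
    (τ : Matrix (∀ v, α v) (∀ v, α v) ℂ) : (applyLocal C τ).trace = τ.trace := by
  have h := sum_mul_applyLocal C τ (fun _ _ => 1)
  simp only [Channel.effect_one, expectation_one, Finset.prod_const_one, one_mul] at h
  exact h

end Local

/-! ### Networks -/

namespace Network

variable {V : Type*} [Fintype V] [DecidableEq V] (G : Network V) (D : Finset V → V → ℕ)

/-- Labels grouped by nodes and labels grouped by sources are the same. -/
def regroup : (∀ v, G.NodeIdx D v) ≃ (∀ e, G.SourceIdx D e) where
  toFun x e v := x v.1 ⟨e, v.2⟩
  invFun z v e := z e.1 ⟨v, e.2⟩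
  left_inv _ := rfl
  right_inv _ := rfl

theorem prod_node_source {M : Type*} [CommMonoid M] (f : ∀ v, {e : G.edges // v ∈ e.1} → M) :
    ∏ v, ∏ e, f v e = ∏ e : G.edges, ∏ v : e.1, f v.1 ⟨e, v.2⟩ := by
  rw [← Fintype.prod_sigma', ← Fintype.prod_sigma']
  exact Fintype.prod_equiv
    { toFun := fun p => ⟨p.2.1, ⟨p.1, p.2.2⟩⟩
      invFun := fun p => ⟨p.2.1, ⟨p.1, p.2.2⟩⟩
      left_inv := fun _ => rfl
      right_inv := fun _ => rfl } _ _ fun _ => rfl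

theorem expectation_sourceProduct
    (γ : ∀ e : G.edges, Matrix (G.SourceIdx D e) (G.SourceIdx D e) ℂ)
    (N : ∀ v, ∀ e : {e : G.edges // v ∈ e.1}, Matrix (Fin (D e.1.1 v)) (Fin (D e.1.1 v)) ℂ) :
    expectation (G.sourceProduct D γ) (fun v => tensor (N v)) =
      ∏ e : G.edges, expectation (γ e) (fun v : e.1 => N v.1 ⟨e, v.2⟩) := by
  simp only [expectation_apply, Finset.prod_univ_sum, Fintype.piFinset_univ]
  rw [← (G.regroup D).sum_comp]
  refine Finset.sum_congr rfl fun x _ => ?_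
  rw [← (G.regroup D).sum_comp]
  refine Finset.sum_congr rfl fun y _ => ?_
  simp only [sourceProduct, tensor, Matrix.of_apply]
  rw [prod_node_source, ← Finset.prod_mul_distrib]
  rfl

theorem tensor_one {ι : Type*} [Fintype ι] {X : ι → Type*} [∀ i, Fintype (X i)]
    [∀ i, DecidableEq (X i)] [DecidableEq ι] : tensor (fun i => (1 : Matrix (X i) (X i) ℂ)) = 1 := by
  ext x y
  rw [tensor, Matrix.of_apply, prod_one_apply, Matrix.one_apply]
  simp only [eq_comm]

theorem tensor_single {ι : Type*} [Fintype ι] {X : ι → Type*} [∀ i, Fintype (X i)]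
    [∀ i, DecidableEq (X i)] [DecidableEq ι] (s t : ∀ i, X i) :
    tensor (fun i => Matrix.single (s i) (t i) (1 : ℂ)) = Matrix.single s t 1 := by
  ext x y
  simp only [tensor, Matrix.of_apply, Matrix.single_apply]
  rw [Finset.prod_ite_zero]
  simp [funext_iff, forall_and]

/-- Factoring each `γ e` as `Bᴴ * B` factors the whole product the same way, after regrouping the
labels by sources. -/
theorem sourceProduct_posSemidef
    {γ : ∀ e : G.edges, Matrix (G.SourceIdx D e) (G.SourceIdx D e) ℂ}
    (hγ : ∀ e, (γ e).PosSemidef) : (G.sourceProduct D γ).PosSemidef := by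
  choose B hB using fun e => exists_eq_conjTranspose_mul_self (hγ e)
  let B' : Matrix (∀ e, G.SourceIdx D e) (∀ v, G.NodeIdx D v) ℂ :=
    Matrix.of fun z x => ∏ e, B e (z e) (G.regroup D x e)
  have : G.sourceProduct D γ = B'ᴴ * B' := by
    ext x y
    simp only [sourceProduct, hB, Matrix.mul_apply, Matrix.of_apply, Matrix.conjTranspose_apply,
      Finset.prod_univ_sum, Fintype.piFinset_univ, B', star_prod, ← Finset.prod_mul_distrib]
    rfl
  rw [this]
  exact Matrix.posSemidef_conjTranspose_mul_self _

theorem sourceProduct_isState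
    {γ : ∀ e : G.edges, Matrix (G.SourceIdx D e) (G.SourceIdx D e) ℂ}
    (hγ : ∀ e, IsState (γ e)) : IsState (G.sourceProduct D γ) where
  posSemidef := G.sourceProduct_posSemidef D fun e => (hγ e).posSemidef
  trace_eq_one := by
    have h := G.expectation_sourceProduct D γ (fun _ _ => 1)
    simp only [tensor_one, expectation_one] at h
    rw [h]
    exact Finset.prod_eq_one fun e _ => (hγ e).trace_eq_one

end Network

/-! ### Inflation -/

section Pair

variable {V : Type*} [Fintype V] [DecidableEq V] {α : V → Type*} [∀ v, Fintype (α v)]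
  [∀ v, DecidableEq (α v)]

/-- A general operator at a node does not factor over the sources, but a matrix unit does. This
expansion reduces two-node expectations to products over the sources. -/
theorem expectation_update_update (τ : Matrix (∀ v, α v) (∀ v, α v) ℂ)
    (N : ∀ v, Matrix (α v) (α v) ℂ) {u w : V} (huw : u ≠ w) (A : Matrix (α u) (α u) ℂ)
    (B : Matrix (α w) (α w) ℂ) :
    expectation τ (update (update N u A) w B) =
      ∑ s, ∑ t, ∑ s', ∑ t', B s t * (A s' t' * expectation τ
        (update (update N u (Matrix.single s' t' 1)) w (Matrix.single s t 1))) := by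
  rw [expectation_update]
  refine Finset.sum_congr rfl fun s _ => Finset.sum_congr rfl fun t _ => ?_
  rw [update_comm huw, expectation_update, Finset.mul_sum]
  refine Finset.sum_congr rfl fun s' _ => ?_
  rw [Finset.mul_sum]
  refine Finset.sum_congr rfl fun t' _ => ?_
  rw [update_comm huw]

theorem sum_pair_applyLocal {β : V → Type*} [∀ v, Fintype (β v)] (C : ∀ v, Channel (α v) (β v))
    (τ : Matrix (∀ v, α v) (∀ v, α v) ℂ) {u w : V} (huw : u ≠ w) (f : β u → ℂ) (g : β w → ℂ) :
    ∑ a, f (a u) * g (a w) * applyLocal C τ a a =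
      expectation τ (update (update (fun _ => 1) u ((C u).effect f)) w ((C w).effect g)) := by
  have h := sum_mul_applyLocal C τ (update (update (fun _ _ => 1) u f) w g)
  have h1 : (fun v => (C v).effect (update (update (fun _ _ => 1) u f) w g v)) =
      update (update (fun _ => 1) u ((C u).effect f)) w ((C w).effect g) := by
    funext v
    by_cases hw : v = w
    · subst hw; simp
    by_cases hu : v = u
    · subst hu; simp [hw]
    · simp [hw, hu, Channel.effect_one]
  rw [h1] at h
  rw [← h]
  refine Finset.sum_congr rfl fun a _ => ?_
  congr 1
  rw [Fintype.prod_eq_mul u w huw]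
  · simp [huw]
  · rintro v ⟨hu, hw⟩
    simp [hu, hw]

theorem sum_single_applyLocal {β : V → Type*} [∀ v, Fintype (β v)]
    (C : ∀ v, Channel (α v) (β v))
    (τ : Matrix (∀ v, α v) (∀ v, α v) ℂ) (u : V) (f : β u → ℂ) :
    ∑ a, f (a u) * applyLocal C τ a a =
      expectation τ (update (fun _ => 1) u ((C u).effect f)) := by
  have h := sum_mul_applyLocal C τ (update (fun _ _ => 1) u f)
  have h1 : (fun v => (C v).effect (update (fun _ _ => 1) u f v)) =
      update (fun _ => 1) u ((C u).effect f) := by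
    funext v
    by_cases hu : v = u
    · subst hu; simp
    · simp [hu, Channel.effect_one]
  rw [h1] at h
  rw [← h]
  refine Finset.sum_congr rfl fun a _ => ?_
  congr 1
  rw [Fintype.prod_eq_single u]
  · simp
  · intro v hu
    simp [hu]

end Pair

namespace Network

set_option linter.unusedSectionVars false

variable {V : Type*} [Fintype V] [DecidableEq V] (G : Network V) (D : Finset V → V → ℕ)

/-- The source states of an inflation: the part of the source `e` held by the nodes of `L e` is
made independent of the remaining part. -/
noncomputable def splitSources (L : G.edges → V → Prop)
    [∀ e, DecidablePred (L e)] (γ : ∀ e : G.edges, Matrix (G.SourceIdx D e) (G.SourceIdx D e) ℂ) (e : G.edges) :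
    Matrix (G.SourceIdx D e) (G.SourceIdx D e) ℂ :=
  splitState (fun v : e.1 => L e v.1) (γ e)

theorem tensor_update
    (N : ∀ v, ∀ e : {e : G.edges // v ∈ e.1}, Matrix (Fin (D e.1.1 v)) (Fin (D e.1.1 v)) ℂ)
    (M : ∀ v, Matrix (G.NodeIdx D v) (G.NodeIdx D v) ℂ) (hM : ∀ v, M v = tensor (N v))
    (u : V) (s t : G.NodeIdx D u) :
    update M u (Matrix.single s t 1) =
      fun v => tensor (update N u (fun e => Matrix.single (s e) (t e) 1) v) := by
  funext v
  by_cases h : v = u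
  · subst h; simp [tensor_single]
  · simp [h, hM]

/-- In each source, whichever of `u`, `w` it reaches lie on one side of the cut, so one factor of
the split expectation is the original and the other is a trace, equal to 1. -/
theorem expectation_splitSources_of_sameSide (L : G.edges → V → Prop) [∀ e, DecidablePred (L e)]
    {γ : ∀ e : G.edges, Matrix (G.SourceIdx D e) (G.SourceIdx D e) ℂ}
    (hγ : ∀ e, IsState (γ e)) {u w : V} (huw : u ≠ w)
    (hL : ∀ e : G.edges, u ∈ e.1 → w ∈ e.1 → (L e u ↔ L e w))
    (A : Matrix (G.NodeIdx D u) (G.NodeIdx D u) ℂ)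
    (B : Matrix (G.NodeIdx D w) (G.NodeIdx D w) ℂ) :
    expectation (G.sourceProduct D (G.splitSources D L γ))
        (update (update (fun _ => 1) u A) w B) =
      expectation (G.sourceProduct D γ) (update (update (fun _ => 1) u A) w B) := by
  rw [expectation_update_update _ _ huw, expectation_update_update _ _ huw]
  refine Finset.sum_congr rfl fun s _ => Finset.sum_congr rfl fun t _ =>
    Finset.sum_congr rfl fun s' _ => Finset.sum_congr rfl fun t' _ => ?_
  congr 2
  rw [G.tensor_update D _ _ (fun v => congrFun (G.tensor_update D (fun _ _ => 1) _
    (fun _ => tensor_one.symm) u s' t') v), expectation_sourceProduct, expectation_sourceProduct]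
  set N : ∀ v, ∀ e : {e : G.edges // v ∈ e.1}, Matrix (Fin (D e.1.1 v)) (Fin (D e.1.1 v)) ℂ :=
    update (update (fun _ _ => 1) u fun e => Matrix.single (s' e) (t' e) 1) w
    (fun e => Matrix.single (s e) (t e) 1) with hN
  have h1 : ∀ v, v ≠ u → v ≠ w → N v = fun _ => 1 := fun v hu hw => by
    rw [hN, update_of_ne hw, update_of_ne hu]
  refine Finset.prod_congr rfl fun e _ => ?_
  rw [splitSources, expectation_splitState]
  have hcase : (∀ v ∈ e.1, (v = u ∨ v = w) → L e v) ∨ (∀ v ∈ e.1, (v = u ∨ v = w) → ¬ L e v) := by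
    by_contra! hcon
    obtain ⟨⟨v, hv, hvuw, hLv⟩, ⟨v', hv', hvuw', hLv'⟩⟩ := hcon
    rcases hvuw with rfl | rfl <;> rcases hvuw' with rfl | rfl
    · exact hLv hLv'
    · exact hLv ((hL e hv hv').2 hLv')
    · exact hLv ((hL e hv' hv).1 hLv')
    · exact hLv hLv'
  rcases hcase with h | h
  · have ha : (fun v : e.1 => if L e v.1 then N v.1 ⟨e, v.2⟩ else 1) =
        fun v : e.1 => N v.1 ⟨e, v.2⟩ := by
      funext v
      split_ifs with hv
      · rfl
      · rw [h1 v.1 (fun h' => hv (h _ v.2 (Or.inl h'))) (fun h' => hv (h _ v.2 (Or.inr h')))]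
    have hb : (fun v : e.1 => if L e v.1 then 1 else N v.1 ⟨e, v.2⟩) = fun v : e.1 => 1 := by
      funext v
      split_ifs with hv
      · rfl
      · rw [h1 v.1 (fun h' => hv (h _ v.2 (Or.inl h'))) (fun h' => hv (h _ v.2 (Or.inr h')))]
    rw [ha, hb, expectation_one, (hγ e).trace_eq_one, mul_one]
  · have ha : (fun v : e.1 => if L e v.1 then N v.1 ⟨e, v.2⟩ else 1) = fun v : e.1 => 1 := by
      funext v
      split_ifs with hv
      · rw [h1 v.1 (fun h' => h _ v.2 (Or.inl h') hv) (fun h' => h _ v.2 (Or.inr h') hv)]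
      · rfl
    have hb : (fun v : e.1 => if L e v.1 then 1 else N v.1 ⟨e, v.2⟩) =
        fun v : e.1 => N v.1 ⟨e, v.2⟩ := by
      funext v
      split_ifs with hv
      · rw [h1 v.1 (fun h' => h _ v.2 (Or.inl h') hv) (fun h' => h _ v.2 (Or.inr h') hv)]
      · rfl
    rw [ha, hb, expectation_one, (hγ e).trace_eq_one, one_mul]

/-- In every source the operator of `u` falls into the `L` factor and that of `w` into the
complementary one, so the expectation splits source by source. -/
theorem expectation_splitSources_of_oppositeSides (L : G.edges → V → Prop) [∀ e, DecidablePred (L e)]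
    (γ : ∀ e : G.edges, Matrix (G.SourceIdx D e) (G.SourceIdx D e) ℂ) {u w : V} (huw : u ≠ w)
    (hu : ∀ e : G.edges, u ∈ e.1 → L e u) (hw : ∀ e : G.edges, w ∈ e.1 → ¬ L e w)
    (A : Matrix (G.NodeIdx D u) (G.NodeIdx D u) ℂ)
    (B : Matrix (G.NodeIdx D w) (G.NodeIdx D w) ℂ) :
    expectation (G.sourceProduct D (G.splitSources D L γ))
        (update (update (fun _ => 1) u A) w B) =
      expectation (G.sourceProduct D γ) (update (fun _ => 1) u A) *
        expectation (G.sourceProduct D γ) (update (fun _ => 1) w B) := by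
  rw [expectation_update_update _ _ huw]
  conv_rhs => rw [expectation_update _ _ w B, expectation_update _ _ u A]
  simp only [Finset.sum_mul, Finset.mul_sum]
  refine Finset.sum_congr rfl fun s _ => Finset.sum_congr rfl fun t _ =>
    Finset.sum_congr rfl fun s' _ => Finset.sum_congr rfl fun t' _ => ?_
  rw [mul_mul_mul_comm, ← mul_assoc, mul_comm (B s t)]
  congr 1
  have ht := fun (v : V) (s t : G.NodeIdx D v) => G.tensor_update D (fun _ _ => 1) _ (fun _ => tensor_one.symm) v s t
  rw [G.tensor_update D _ _ (fun v => congrFun (ht u s' t') v), ht, ht]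
  simp only [expectation_sourceProduct]
  rw [← Finset.prod_mul_distrib]
  refine Finset.prod_congr rfl fun e _ => ?_
  rw [splitSources, expectation_splitState]
  congr 2
  · funext v
    split_ifs with hv
    · by_cases h : v.1 = w
      · exact absurd hv (h ▸ hw e (h ▸ v.2))
      · simp [h]
    · by_cases h : v.1 = u
      · exact absurd (h ▸ hu e (h ▸ v.2)) hv
      · simp [h]
  · funext v
    split_ifs with hv
    · by_cases h : v.1 = w
      · exact absurd hv (h ▸ hw e (h ▸ v.2))
      · simp [h]
    · by_cases h : v.1 = u
      · exact absurd (h ▸ hu e (h ▸ v.2)) hv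
      · rcases v with ⟨v, hve⟩
        by_cases h' : v = w
        · subst h'; simp
        · simp_all

/-- Given nodes `t 0, …, t k` of a `k`-network, there is a joint distribution of the outcomes of
all the nodes in which consecutive nodes have the same correlations as in the network while
`t 0` and `t k` are independent. -/
theorem exists_inflation {k : ℕ} (hk : 1 ≤ k) (hG : G.IsKNetwork k) {β : V → Type*}
    [∀ v, Fintype (β v)] (C : ∀ v, Channel (G.NodeIdx D v) (β v))
    {γ : ∀ e : G.edges, Matrix (G.SourceIdx D e) (G.SourceIdx D e) ℂ}
    (hγ : ∀ e, IsState (γ e)) (P : (∀ v, β v) → ℝ)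
    (hP : ∀ a, applyLocal C (G.sourceProduct D γ) a a = P a)
    {t : Fin (k + 1) → V} (ht : Injective t) :
    ∃ P' : (∀ v, β v) → ℝ, (∀ a, 0 ≤ P' a) ∧ ∑ a, P' a = 1 ∧
      (∀ (j : Fin k) (f : β (t j.castSucc) → ℝ) (g : β (t j.succ) → ℝ),
        ∑ a, f (a (t j.castSucc)) * g (a (t j.succ)) * P' a =
          ∑ a, f (a (t j.castSucc)) * g (a (t j.succ)) * P a) ∧
      ∀ (f : β (t 0) → ℝ) (g : β (t (Fin.last k)) → ℝ),
        ∑ a, f (a (t 0)) * g (a (t (Fin.last k))) * P' a =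
          (∑ a, f (a (t 0)) * P a) * ∑ a, g (a (t (Fin.last k))) * P a := by
  classical
  -- A source with at most `k` nodes cannot contain `k + 1` distinct ones.
  have hm : ∀ e : G.edges, ∃ m, t m ∉ e.1 := by
    intro e
    by_contra! h
    have h1 : (Finset.univ.image t).card ≤ e.1.card :=
      Finset.card_le_card fun v hv => by
        obtain ⟨j, -, rfl⟩ := Finset.mem_image.1 hv
        exact h j
    rw [Finset.card_image_of_injective _ ht, Finset.card_univ, Fintype.card_fin] at h1
    have := hG e.1 e.2
    omega
  choose m hm using hm
  -- Each source is cut at the node `t (m e)` that it misses; nodes outside the chain go to the far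
  -- side.
  let L : G.edges → V → Prop := fun e v => ∃ j, j < m e ∧ t j = v
  have hL : ∀ e j, L e (t j) ↔ j < m e := fun e j =>
    ⟨fun ⟨i, hi, hij⟩ => ht hij ▸ hi, fun h => ⟨j, h, rfl⟩⟩
  have hstate : IsState (G.sourceProduct D (G.splitSources D L γ)) :=
    G.sourceProduct_isState D fun e => splitState_isState _ (hγ e)
  have hpsd := applyLocal_posSemidef C hstate.posSemidef
  obtain ⟨P', hP'⟩ : ∃ P' : (∀ v, β v) → ℝ, ∀ a,
      applyLocal C (G.sourceProduct D (G.splitSources D L γ)) a a = P' a :=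
    ⟨_, fun a => Complex.eq_re_of_ofReal_le (r := 0) (by simpa using hpsd.diag_nonneg)⟩
  refine ⟨P', fun a => ?_, ?_, ?_, ?_⟩
  · exact Complex.zero_le_real.1 (hP' a ▸ hpsd.diag_nonneg)
  · have := applyLocal_trace C (G.sourceProduct D (G.splitSources D L γ))
    rw [hstate.trace_eq_one, Matrix.trace] at this
    simp only [Matrix.diag_apply, hP'] at this
    exact_mod_cast this
  · intro j f g
    have hne : t j.castSucc ≠ t j.succ := ht.ne (Fin.castSucc_lt_succ (i := j)).ne
    have h := sum_pair_applyLocal C (G.sourceProduct D (G.splitSources D L γ)) hne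
      (fun b => (f b : ℂ)) (fun b => (g b : ℂ))
    rw [expectation_splitSources_of_sameSide G D L hγ hne, ← sum_pair_applyLocal C _ hne] at h
    · simp_rw [hP] at h
      simp_rw [hP'] at h
      exact_mod_cast h
    · intro e _ he
      rw [hL, hL]
      -- If `t j.succ` belongs to `e`, the cut is not at `j + 1`, so `j < m e` and `j + 1 < m e` are
      -- equivalent.
      have : j.succ ≠ m e := fun h' => hm e (h' ▸ he)
      rw [Ne, Fin.ext_iff] at this
      simp only [Fin.lt_def, Fin.val_succ, Fin.val_castSucc] at this ⊢
      omega
  · intro f g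
    have hne : t 0 ≠ t (Fin.last k) := ht.ne (Fin.ne_of_lt (by simp [Fin.lt_def]; omega))
    have h := sum_pair_applyLocal C (G.sourceProduct D (G.splitSources D L γ)) hne
      (fun b => (f b : ℂ)) (fun b => (g b : ℂ))
    rw [expectation_splitSources_of_oppositeSides G D L γ hne, ← sum_single_applyLocal C,
      ← sum_single_applyLocal C] at h
    · simp_rw [hP] at h
      simp_rw [hP'] at h
      exact_mod_cast h
    · intro e he
      rw [hL]
      exact Fin.pos_of_ne_zero fun h' => hm e (h' ▸ he)
    · intro e _
      rw [hL]
      exact (Fin.le_last _).not_gt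

end Network

/-! ### Classical inequalities -/

/-- Cauchy–Schwarz over the `card ι * (card ι - 1)` ordered pairs of distinct indices, applied to
the products `x i * x j`. -/
theorem sq_sum_sub_sum_sq_sq_le {ι : Type*} [Fintype ι] [DecidableEq ι] (x : ι → ℝ) :
    ((∑ i, x i) ^ 2 - ∑ i, x i ^ 2) ^ 2 ≤
      (Fintype.card ι : ℝ) * (Fintype.card ι - 1) * ((∑ i, x i ^ 2) ^ 2 - ∑ i, x i ^ 4) := by
  have h : ∀ y : ι → ℝ, (∑ i, y i) ^ 2 - ∑ i, y i ^ 2 =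
      ∑ p ∈ (Finset.univ : Finset ι).offDiag, y p.1 * y p.2 := by
    intro y
    rw [sq, Finset.sum_mul_sum, ← Finset.sum_product', ← Finset.diag_union_offDiag,
      Finset.sum_union (Finset.disjoint_diag_offDiag _), Finset.sum_diag]
    simp [sq]
  have h2 := sq_sum_le_card_mul_sum_sq (s := (Finset.univ : Finset ι).offDiag)
    (f := fun p => x p.1 * x p.2)
  rw [h, show ∑ i, x i ^ 4 = ∑ i, (x i ^ 2) ^ 2 by simp [← pow_mul], h fun i => x i ^ 2]
  simp only [← mul_pow]
  refine h2.trans (le_of_eq ?_)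
  congr 1
  rw [Finset.offDiag_card, Finset.card_univ, Nat.cast_sub (Nat.le_mul_self _)]
  push_cast; ring

/-- Put `κ = 1 - 1 / m`. The hypotheses give `S - (1 - ε) ≤ (d - 1) (2κ - (1 - ε))`; since `1 - ε ≥
κ` and `d ≥ 2`, the resulting bound on `S` is at most `d κ`. -/
theorem le_of_sq_sub_le {d m ε δ A S : ℝ} (hd : 2 ≤ d) (hm : 3 ≤ m) (hε0 : 0 ≤ ε) (hε : ε < 1 / m)
    (hδ : d * δ = 1) (hA : (1 - δ) * ((1 / m - ε) * (m - ε)) ≤ A)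
    (hS : (S - (1 - ε)) ^ 2 ≤ d * (d - 1) * ((1 - ε) ^ 2 - ((1 - ε) ^ 2 * δ + A))) :
    S ≤ d * (1 - 1 / m) := by
  obtain ⟨κ, hκ⟩ : ∃ κ, κ = 1 - 1 / m := ⟨_, rfl⟩
  have h2 : 1 / m = 1 - κ := by rw [hκ]; ring
  have hmκ : m * κ = m - 1 := by
    rw [hκ, mul_sub, mul_one, mul_one_div_cancel (by linarith)]
  rw [h2] at hA hε
  rw [← hκ]
  clear hκ h2
  have hκ0 : 2 / 3 ≤ κ := by nlinarith
  -- This is where `m ≥ 3` is essential: since `ε < 1 / m`, it reduces to `4 (m - 1) ≤ m² - 1`.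
  have h1 : 4 * κ ≤ m - ε := by
    have : m * (4 * κ) ≤ m * (m - (1 - κ)) := by nlinarith
    have := le_of_mul_le_mul_left this (by linarith)
    linarith
  have hC : (1 - ε) ^ 2 - (2 * κ - (1 - ε)) ^ 2 ≤ (1 - κ - ε) * (m - ε) := by
    nlinarith [mul_le_mul_of_nonneg_left h1 (by linarith : 0 ≤ 1 - κ - ε)]
  have hT2 : (S - (1 - ε)) ^ 2 ≤ ((d - 1) * (2 * κ - (1 - ε))) ^ 2 := by
    refine hS.trans ?_
    have e1 : d * (d - 1) * ((1 - ε) ^ 2 - ((1 - ε) ^ 2 * δ + A)) =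
        (d - 1) ^ 2 * (1 - ε) ^ 2 - (d - 1) * (d * A) := by
      linear_combination (-(d - 1) * (1 - ε) ^ 2) * hδ
    have e2 : (d - 1) * ((1 - κ - ε) * (m - ε)) ≤ d * A := by
      have := mul_le_mul_of_nonneg_left hA (by linarith : 0 ≤ d)
      rwa [← mul_assoc, mul_sub, hδ, mul_one] at this
    rw [e1]
    have e3 := mul_le_mul_of_nonneg_left e2 (by linarith : 0 ≤ d - 1)
    have e4 := mul_le_mul_of_nonneg_left hC (sq_nonneg (d - 1))
    nlinarith
  have hTle := abs_le_of_sq_le_sq' hT2 (mul_nonneg (by linarith) ?_)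
  · nlinarith [hTle.2, mul_nonneg (by linarith : 0 ≤ d - 2) (by linarith : 0 ≤ 1 - ε - κ)]
  · linarith

/-- A defect `ε ≥ 1 / m` already suffices by Cauchy–Schwarz. For smaller `ε` the hypotheses force
the `x i ^ 2` to be far from uniform (`A` is large), which lowers `∑ i, x i`. -/
theorem sq_sum_le_of_variance {d m : ℕ} (hd : 2 ≤ d) (hm : 3 ≤ m) (x w : Fin d → ℝ) {ε X : ℝ}
    (hε : ∑ i, x i ^ 2 = 1 - ε) (hε0 : 0 ≤ ε) (hw : ∑ i, w i = ε) (hX : 0 ≤ X)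
    (hwX : ∑ i, w i ^ 2 ≤ ε * X)
    (h : 1 - ∑ i, (x i ^ 2 + w i) ^ 2 ≤ m * (ε - X)) :
    (∑ i, x i) ^ 2 ≤ d * (1 - 1 / m) := by
  have hd' : (2 : ℝ) ≤ d := by exact_mod_cast hd
  have hm' : (3 : ℝ) ≤ m := by exact_mod_cast hm
  rcases le_or_gt (1 / (m : ℝ)) ε with hεm | hεm
  · have := sq_sum_le_card_mul_sum_sq (s := Finset.univ) (f := x)
    rw [hε, Finset.card_univ, Fintype.card_fin] at this
    exact this.trans (mul_le_mul_of_nonneg_left (by linarith) (by linarith))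
  have hmε : m * ε < 1 := by rwa [lt_div_iff₀ (by linarith), mul_comm] at hεm
  have hεlt : ε < 1 := by nlinarith
  set δ : ℝ := 1 / d with hδ
  have hδd : d * δ = 1 := by rw [hδ]; field_simp
  set q : Fin d → ℝ := fun i => x i ^ 2 - (1 - ε) * δ with hq
  set w' : Fin d → ℝ := fun i => w i - ε * δ with hw'
  set A := ∑ i, q i ^ 2 with hA
  set W := ∑ i, w' i ^ 2 with hW
  set Z := ∑ i, (q i + w' i) ^ 2 with hZ
  have center : ∀ (y : Fin d → ℝ) (c : ℝ), ∑ i, y i = c →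
      ∑ i, y i ^ 2 = c ^ 2 * δ + ∑ i, (y i - c * δ) ^ 2 := by
    intro y c hy
    have : ∀ i, (y i - c * δ) ^ 2 = y i ^ 2 - 2 * c * δ * y i + (c * δ) ^ 2 := fun i => by ring
    simp only [this, Finset.sum_add_distrib, Finset.sum_sub_distrib, ← Finset.mul_sum, hy,
      Finset.sum_const, Finset.card_univ, Fintype.card_fin, nsmul_eq_mul]
    linear_combination (-c ^ 2 * δ) * hδd
  have hx4 : ∑ i, (x i ^ 2) ^ 2 = (1 - ε) ^ 2 * δ + A := center _ _ hε
  have hw2 : ∑ i, w i ^ 2 = ε ^ 2 * δ + W := center _ _ hw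
  have hsum : ∑ i, (x i ^ 2 + w i) ^ 2 = δ + Z := by
    rw [center _ 1 (by rw [Finset.sum_add_distrib, hε, hw]; ring)]
    simp only [hZ, hq, hw']
    congr 1
    · ring
    · exact Finset.sum_congr rfl fun i _ => by ring
  rw [hsum] at h
  rw [hw2] at hwX
  have hW0 : 0 ≤ W := Finset.sum_nonneg fun i _ => sq_nonneg _
  have hmδ : 0 < m - ε := by linarith
  have hAm : (1 - δ) * ((m - ε) * (1 - m * ε)) ≤ m * A := by
    rcases hε0.eq_or_lt with h0 | h0
    · subst h0
      have hWz : W = 0 := by linarith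
      have hw0 : ∀ i, w' i = 0 := fun i => by
        have := (Finset.sum_eq_zero_iff_of_nonneg (fun i _ => sq_nonneg (w' i))).1 hWz i
          (Finset.mem_univ i)
        exact pow_eq_zero_iff (two_ne_zero) |>.1 this
      have hZA : Z = A := by simp [hZ, hA, hw0]
      rw [hZA] at h
      have h1 : 1 - δ ≤ A := by nlinarith [mul_nonneg (by linarith : (0 : ℝ) ≤ m) hX]
      have h2 := mul_le_mul_of_nonneg_left h1 (by linarith : (0 : ℝ) ≤ m)
      linarith
    -- Weighted Young inequality whose slack is `(ε q - (m - ε) w')²`; the weights are chosen so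
    -- that the terms in `W` cancel against those coming from `hwX`.
    · have hZle : ε * (m - ε) * Z ≤ m * ε * A + m * (m - ε) * W := by
        rw [hZ, hA, hW, Finset.mul_sum, Finset.mul_sum, Finset.mul_sum, ← Finset.sum_add_distrib]
        refine Finset.sum_le_sum fun i _ => ?_
        nlinarith [sq_nonneg (ε * q i - (m - ε) * w' i)]
      have h1 : ε * (1 - δ) * (1 - m * ε) ≤ ε * Z - m * W := by
        nlinarith [mul_le_mul_of_nonneg_left h hε0]
      have h2 := mul_le_mul_of_nonneg_left h1 hmδ.le
      refine le_of_mul_le_mul_left ?_ h0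
      nlinarith
  have hA2 : (1 - δ) * ((1 / m - ε) * (m - ε)) ≤ A := by
    refine le_of_mul_le_mul_left (le_trans (le_of_eq ?_) hAm) (by linarith : (0 : ℝ) < m)
    field_simp
  have hT := sq_sum_sub_sum_sq_sq_le x
  rw [show ∑ i, x i ^ 4 = ∑ i, (x i ^ 2) ^ 2 by simp [← pow_mul], hx4, hε, Fintype.card_fin] at hT
  refine le_of_sq_sub_le hd' hm' hε0 hεm hδd hA2 hT

/-! ### Averaging over the orderings of the nodes -/

/-- The symmetric group acts transitively on ordered pairs of distinct elements, so the image of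
`(x, y)` under a uniform permutation is uniform among them. -/
theorem sum_perm_apply_pair {m : ℕ} (g : Fin m → Fin m → ℝ) {x y : Fin m} (hxy : x ≠ y) :
    (m : ℝ) * (m - 1) * ∑ π : Equiv.Perm (Fin m), g (π x) (π y) =
      (m.factorial : ℝ) * ∑ p ∈ (Finset.univ : Finset (Fin m)).offDiag, g p.1 p.2 := by
  have h1 : ∀ p ∈ (Finset.univ : Finset (Fin m)).offDiag,
      ∑ π : Equiv.Perm (Fin m), g (π p.1) (π p.2) =
        ∑ π : Equiv.Perm (Fin m), g (π x) (π y) := by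
    rintro ⟨u, w⟩ h
    have huw : u ≠ w := by simpa using h
    let τ : Equiv.Perm (Fin m) := Equiv.swap u x * Equiv.swap w (Equiv.swap u x y)
    have hy : Equiv.swap u x y ≠ u := fun h' => hxy (by
      have := congrArg (Equiv.swap u x) h'
      simpa using this.symm)
    have hτu : τ u = x := by
      simp only [τ, Equiv.Perm.mul_apply]
      rw [Equiv.swap_apply_of_ne_of_ne huw hy.symm, Equiv.swap_apply_left]
    have hτw : τ w = y := by simp [τ]
    rw [← Equiv.sum_comp (Equiv.mulRight τ)]
    simp [hτu, hτw]
  have h2 : ∀ π : Equiv.Perm (Fin m),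
      ∑ p ∈ (Finset.univ : Finset (Fin m)).offDiag, g (π p.1) (π p.2) =
        ∑ p ∈ (Finset.univ : Finset (Fin m)).offDiag, g p.1 p.2 := fun π =>
    Finset.sum_equiv (π.prodCongr π) (by simp) (by simp)
  have h3 := Finset.sum_congr rfl h1
  rw [Finset.sum_comm, Finset.sum_congr rfl fun π _ => h2 π, Finset.sum_const, Finset.sum_const,
    Finset.offDiag_card, Finset.card_univ, Finset.card_univ, Fintype.card_perm, Fintype.card_fin,
    nsmul_eq_mul, nsmul_eq_mul, Nat.cast_sub (Nat.le_mul_self _)] at h3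
  rw [h3]
  push_cast
  ring

theorem sum_offDiag_eq {ι : Type*} [Fintype ι] [DecidableEq ι] (g : ι → ι → ℝ) :
    ∑ p ∈ (Finset.univ : Finset ι).offDiag, g p.1 p.2 = ∑ u, ∑ w, g u w - ∑ u, g u u := by
  rw [← Finset.sum_product', ← Finset.diag_union_offDiag,
    Finset.sum_union (Finset.disjoint_diag_offDiag _), Finset.sum_diag]
  ring

theorem le_sum_of_chain {k : ℕ} (hk : 1 ≤ k) (H E : Fin (k + 1) → Fin (k + 1) → ℝ)
    (h : ∀ π : Equiv.Perm (Fin (k + 1)),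
      1 ≤ H (π 0) (π (Fin.last k)) + ∑ j : Fin k, E (π j.castSucc) (π j.succ)) :
    ((k : ℝ) + 1) * k ≤ (∑ u, ∑ w, H u w - ∑ u, H u u) +
      k * (∑ u, ∑ w, E u w - ∑ u, E u u) := by
  rw [← sum_offDiag_eq, ← sum_offDiag_eq]
  have h0 : (0 : Fin (k + 1)) ≠ Fin.last k := Fin.ne_of_lt (by simp [Fin.lt_def]; omega)
  have hs := Finset.sum_le_sum fun π (_ : π ∈ Finset.univ) => h π
  rw [Finset.sum_add_distrib, Finset.sum_comm, Finset.sum_const, Finset.card_univ,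
    Fintype.card_perm, Fintype.card_fin, nsmul_eq_mul, mul_one] at hs
  have hH := sum_perm_apply_pair H h0
  have hE := fun j : Fin k =>
    sum_perm_apply_pair E (Fin.castSucc_lt_succ (i := j)).ne
  have hE' := Finset.sum_congr rfl fun j (_ : j ∈ Finset.univ) => hE j
  rw [← Finset.mul_sum, Finset.sum_const, Finset.card_univ, Fintype.card_fin,
    nsmul_eq_mul] at hE'
  push_cast at hH hE'
  have hf : (0 : ℝ) < (k + 1).factorial := by exact_mod_cast Nat.factorial_pos _
  have hk0 : (0 : ℝ) ≤ ((k : ℝ) + 1) * (k + 1 - 1) := by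
    rw [add_sub_cancel_right]; positivity
  have := mul_le_mul_of_nonneg_left hs hk0
  rw [mul_add, hH, hE'] at this
  refine le_of_mul_le_mul_left ?_ hf
  linarith

/-- Suppose that `k + 1` random variables `A u` with `d` values satisfy, for every ordering, the
inequality valid when the two ends of the chain can be made independent without changing the
correlations between neighbours. Then the probabilities `Q i` that all of them equal `i` satisfy
`(∑ i, √(Q i)) ^ 2 ≤ d * (1 - 1 / (k + 1))`. -/
theorem sq_sum_sqrt_le_of_chain {d k : ℕ} (hd : 2 ≤ d) (hk : 2 ≤ k) {Ω : Type*} [Fintype Ω]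
    {P : Ω → ℝ} (hP : ∀ ω, 0 ≤ P ω) (hP1 : ∑ ω, P ω = 1) (A : Fin (k + 1) → Ω → Fin d)
    (h : ∀ π : Equiv.Perm (Fin (k + 1)),
      1 ≤ ∑ i, (∑ ω, (if A (π 0) ω = i then 1 else 0) * P ω) *
          (∑ ω, (if A (π (Fin.last k)) ω = i then 1 else 0) * P ω) +
        ∑ j : Fin k, ∑ ω, (if A (π j.castSucc) ω = A (π j.succ) ω then 0 else 1) * P ω) :
    (∑ i, √(∑ ω, (if ∀ u, A u ω = i then 1 else 0) * P ω)) ^ 2 ≤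
      d * (1 - 1 / ((k + 1 : ℕ) : ℝ)) := by
  classical
  have hk0 : (0 : ℝ) < k := by exact_mod_cast (by omega : 0 < k)
  set m : ℝ := ((k + 1 : ℕ) : ℝ) with hm
  have hmk : m = k + 1 := by rw [hm]; push_cast; ring
  have hm0 : 0 < m := by linarith
  set pm : Fin (k + 1) → Fin d → ℝ := fun u i => ∑ ω, (if A u ω = i then 1 else 0) * P ω with hpm
  set c : Fin d → Ω → ℝ := fun i ω => ∑ u, if A u ω = i then 1 else 0 with hc
  set N : Fin d → ℝ := fun i => ∑ ω, c i ω * P ω with hN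
  set Q : Fin d → ℝ := fun i => ∑ ω, (if ∀ u, A u ω = i then 1 else 0) * P ω with hQ
  -- Indicator of a non-unanimous outcome; `c i ω` above counts the variables with value `i`.
  set e : Ω → ℝ := fun ω => if ∃ i, ∀ u, A u ω = i then 0 else 1 with he
  have hav := le_sum_of_chain (by omega) (fun u w => ∑ i, pm u i * pm w i)
    (fun u w => ∑ ω, (if A u ω = A w ω then 0 else 1) * P ω) h
  have hNpm : ∀ i, N i = ∑ u, pm u i := fun i => by
    simp only [hN, hc, hpm, Finset.sum_mul]
    exact Finset.sum_comm
  have hH1 : ∑ u, ∑ w, ∑ i, pm u i * pm w i = ∑ i, N i ^ 2 := by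
    simp only [hNpm, sq, Finset.sum_mul_sum]
    rw [Finset.sum_congr rfl fun u _ => Finset.sum_comm, Finset.sum_comm]
  have hH2 : (∑ i, N i ^ 2) / m ≤ ∑ u, ∑ i, pm u i * pm u i := by
    rw [Finset.sum_comm, Finset.sum_div]
    refine Finset.sum_le_sum fun i _ => ?_
    rw [div_le_iff₀ hm0, hNpm, mul_comm]
    have := sq_sum_le_card_mul_sum_sq (s := Finset.univ) (f := fun u => pm u i)
    rw [Finset.card_univ, Fintype.card_fin] at this
    simpa only [sq (pm _ _)] using this
  have hc2 : ∀ ω, ∑ i, c i ω ^ 2 =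
      ∑ u, ∑ w, if A u ω = A w ω then (1 : ℝ) else 0 := by
    intro ω
    simp only [hc, sq, Finset.sum_mul_sum]
    rw [Finset.sum_comm]
    refine Finset.sum_congr rfl fun u _ => ?_
    rw [Finset.sum_comm]
    refine Finset.sum_congr rfl fun w _ => ?_
    simp [eq_comm]
  have hE1 : ∑ u, ∑ w, ∑ ω, (if A u ω = A w ω then 0 else 1) * P ω =
      m ^ 2 - ∑ ω, (∑ i, c i ω ^ 2) * P ω := by
    have : ∀ ω, ∑ u, ∑ w, (if A u ω = A w ω then (0 : ℝ) else 1) = m ^ 2 - ∑ i, c i ω ^ 2 := by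
      intro ω
      have h1 : ∀ u w, (if A u ω = A w ω then (0 : ℝ) else 1) =
          1 - if A u ω = A w ω then 1 else 0 := fun u w => by split_ifs <;> norm_num
      simp only [hc2, h1, Finset.sum_sub_distrib]
      simp [sq, hm]
      ring
    rw [Finset.sum_congr rfl fun u _ => Finset.sum_comm, Finset.sum_comm]
    simp only [← Finset.sum_mul, this, sub_mul, Finset.sum_sub_distrib, ← Finset.mul_sum, hP1,
      mul_one]
  have hE2 : ∑ u, ∑ ω, (if A u ω = A u ω then (0 : ℝ) else 1) * P ω = 0 := by simp
  rw [hH1, hE1, hE2] at hav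
  have hQ0 : ∀ i, 0 ≤ Q i := fun i => Finset.sum_nonneg fun ω _ =>
    mul_nonneg (by split_ifs <;> norm_num) (hP ω)
  -- On unanimous outcomes the frequency `c i ω / m` is 0 or 1, hence equal to its square; `w` and
  -- `X` collect the remaining first and second moments.
  have hsplit : ∀ i ω, c i ω / m = (if ∀ u, A u ω = i then 1 else 0) + e ω * (c i ω / m) := by
    intro i ω
    by_cases hω : ∃ i, ∀ u, A u ω = i
    · obtain ⟨i', hi'⟩ := hω
      have he0 : e ω = 0 := if_pos ⟨i', hi'⟩
      rw [he0, zero_mul, add_zero]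
      simp only [hc, hi']
      by_cases hii : i' = i
      · simp [hii, hm]
        exact (by positivity : (k : ℝ) + 1 ≠ 0)
      · simp [hii]
    · have he1 : e ω = 1 := if_neg hω
      rw [he1, if_neg fun h' => hω ⟨i, h'⟩]
      ring
  have hsplit2 : ∀ i ω, (c i ω / m) ^ 2 =
      (if ∀ u, A u ω = i then 1 else 0) + e ω * (c i ω / m) ^ 2 := by
    intro i ω
    have h1 := hsplit i ω
    by_cases hω : ∃ i, ∀ u, A u ω = i
    · have he0 : e ω = 0 := if_pos hω
      rw [he0, zero_mul, add_zero] at h1 ⊢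
      rw [h1]; split_ifs <;> norm_num
    · have he1 : e ω = 1 := if_neg hω
      rw [he1, if_neg fun h' => hω ⟨i, h'⟩]
      ring
  have he0 : ∀ ω, 0 ≤ e ω := fun ω => by simp only [he]; split_ifs <;> norm_num
  have hcsum : ∀ ω, ∑ i, c i ω = m := fun ω => by
    simp only [hc]
    rw [Finset.sum_comm]
    simp [hm]
  set w : Fin d → ℝ := fun i => ∑ ω, e ω * (c i ω / m) * P ω with hw
  set X : ℝ := ∑ i, ∑ ω, e ω * (c i ω / m) ^ 2 * P ω with hX
  set ε : ℝ := ∑ ω, e ω * P ω with hε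
  have hQw : ∀ i, N i / m = Q i + w i := fun i => by
    simp only [hN, hQ, hw, ← Finset.sum_add_distrib, ← add_mul, ← hsplit]
    rw [Finset.sum_div]
    exact Finset.sum_congr rfl fun ω _ => by ring
  have hwε : ∑ i, w i = ε := by
    simp only [hw, hε]
    rw [Finset.sum_comm]
    refine Finset.sum_congr rfl fun ω _ => ?_
    rw [← Finset.sum_mul, ← Finset.mul_sum, ← Finset.sum_div, hcsum, div_self hm0.ne', mul_one]
  have hNsum : ∑ i, N i / m = 1 := by
    simp only [hN]
    rw [← Finset.sum_div, Finset.sum_comm]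
    simp only [← Finset.sum_mul, hcsum]
    rw [← Finset.mul_sum, hP1, mul_one, div_self hm0.ne']
  have hQε : ∑ i, Q i = 1 - ε := by
    rw [← hNsum, ← hwε, ← Finset.sum_sub_distrib]
    exact Finset.sum_congr rfl fun i _ => by rw [hQw]; ring
  have hY : ∑ ω, (∑ i, c i ω ^ 2) * P ω = m ^ 2 * (1 - ε + X) := by
    rw [← hQε, hX, ← Finset.sum_add_distrib, Finset.mul_sum]
    simp only [hQ, ← Finset.sum_add_distrib, ← add_mul, ← hsplit2, Finset.sum_mul, Finset.mul_sum]
    rw [Finset.sum_comm]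
    refine Finset.sum_congr rfl fun i _ => Finset.sum_congr rfl fun ω _ => ?_
    field_simp
  have hX0 : 0 ≤ X := Finset.sum_nonneg fun i _ => Finset.sum_nonneg fun ω _ =>
    mul_nonneg (mul_nonneg (he0 ω) (sq_nonneg _)) (hP ω)
  refine sq_sum_le_of_variance hd (by omega) (fun i => √(Q i)) w (ε := ε) (X := X) ?_
    (Finset.sum_nonneg fun ω _ => mul_nonneg (he0 ω) (hP ω)) hwε hX0 ?_ ?_
  · simp only [Real.sq_sqrt (hQ0 _), hQε]
  · rw [hX, Finset.mul_sum]
    refine Finset.sum_le_sum fun i _ => ?_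
    refine Finset.sum_sq_le_sum_mul_sum_of_sq_le_mul _ (fun ω _ => mul_nonneg (he0 ω) (hP ω))
      (fun ω _ => mul_nonneg (mul_nonneg (he0 ω) (sq_nonneg _)) (hP ω)) fun ω _ => le_of_eq (by ring)
  · simp only [Real.sq_sqrt (hQ0 _), ← hQw, div_pow]
    rw [← Finset.sum_div, ← hm]
    rw [hY] at hav
    set S := ∑ i, N i ^ 2
    -- Bounding the diagonal terms below by `S / m` leaves `S - S / m = k (S / m)`, so every term
    -- carries a factor `k`, cancelled next.
    have h1 : m * k ≤ k * (S / m) + k * (m ^ 2 * (ε - X)) := by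
      have : S - S / m = k * (S / m) := by
        field_simp
        rw [hmk]; ring
      rw [← hmk] at hav
      linarith
    have h2 : m ≤ S / m + m ^ 2 * (ε - X) :=
      le_of_mul_le_mul_left (by linarith) hk0
    have h3 : m * (S / m ^ 2) = S / m := by field_simp
    refine le_of_mul_le_mul_left ?_ hm0
    nlinarith

/-! ### Overlap with the GHZ state -/

theorem ghz_eq_sum_single (n d : ℕ) :
    ghz n d = (1 / (d : ℂ)) • ∑ i : Fin d, ∑ j : Fin d,
      Matrix.single (fun _ : Fin n => i) (fun _ => j) (1 : ℂ) := by
  rw [ghz]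
  congr 1
  refine Finset.sum_congr rfl fun i _ => Finset.sum_congr rfl fun j _ => ?_
  exact Network.tensor_single (fun _ : Fin n => i) (fun _ => j)

theorem trace_ghz_mul {n d : ℕ} (M : Matrix (Fin n → Fin d) (Fin n → Fin d) ℂ) :
    (ghz n d * M).trace = (1 / (d : ℂ)) * ∑ i : Fin d, ∑ j : Fin d, M (fun _ => j) (fun _ => i) := by
  rw [ghz_eq_sum_single, Matrix.smul_mul, Matrix.trace_smul, smul_eq_mul, Finset.sum_mul,
    Matrix.trace_sum]
  congr 1
  refine Finset.sum_congr rfl fun i _ => ?_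
  rw [Finset.sum_mul, Matrix.trace_sum]
  simp [Matrix.trace_single_mul]

/-- Writing `M` as a Gram matrix, the left side is `‖∑ i, b i‖²` and the right side is `(∑ i, ‖b
i‖)²`. -/
theorem re_sum_sum_le_sq_sum_sqrt {ι κ : Type*} [Fintype ι] [Fintype κ] {M : Matrix κ κ ℂ}
    (hM : M.PosSemidef) (s : ι → κ) :
    (∑ i, ∑ j, M (s j) (s i)).re ≤ (∑ i, √(M (s i) (s i)).re) ^ 2 := by
  obtain ⟨B, rfl⟩ := exists_eq_conjTranspose_mul_self hM
  let b : ι → EuclideanSpace ℂ κ := fun i => WithLp.toLp 2 fun z => B z (s i)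
  have hb : ∀ i j, (Bᴴ * B) (s j) (s i) = inner ℂ (b j) (b i) := fun i j => by
    simp [Matrix.mul_apply, b, PiLp.inner_apply, mul_comm]
  have hn : ∀ i, √((Bᴴ * B) (s i) (s i)).re = ‖b i‖ := fun i => by
    rw [hb, inner_self_eq_norm_sq_to_K]
    norm_cast
    exact Real.sqrt_sq (norm_nonneg _)
  simp only [hn]
  simp only [hb]
  have : ∑ i, ∑ j, inner ℂ (b j) (b i) = inner ℂ (∑ j, b j) (∑ i, b i) := by
    simp only [sum_inner, inner_sum]
  rw [this, inner_self_eq_norm_sq_to_K]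
  norm_cast
  exact pow_le_pow_left₀ (norm_nonneg _) (norm_sum_le _ _) 2

theorem re_trace_ghz_mul_le {n d : ℕ} {M : Matrix (Fin n → Fin d) (Fin n → Fin d) ℂ}
    (hM : M.PosSemidef) :
    (ghz n d * M).trace.re ≤ (∑ i : Fin d, √(M (fun _ => i) (fun _ => i)).re) ^ 2 / d := by
  rw [trace_ghz_mul, show (1 / (d : ℂ)) = ((1 / d : ℝ) : ℂ) by push_cast; rfl, Complex.re_ofReal_mul,
    one_div, inv_mul_eq_div]
  exact div_le_div_of_nonneg_right (re_sum_sum_le_sq_sum_sqrt hM _) (Nat.cast_nonneg _)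

theorem re_trace_ghz_mul_le_re_trace {n d : ℕ} (hn : 0 < n) (hd : 0 < d)
    {M : Matrix (Fin n → Fin d) (Fin n → Fin d) ℂ} (hM : M.PosSemidef) :
    (ghz n d * M).trace.re ≤ M.trace.re := by
  have hd' : (0 : ℝ) < d := by exact_mod_cast hd
  have h0 : ∀ a, 0 ≤ (M a a).re := fun a => (Complex.nonneg_iff.1 hM.diag_nonneg).1
  refine (re_trace_ghz_mul_le hM).trans ?_
  rw [div_le_iff₀ hd']
  have h := sq_sum_le_card_mul_sum_sq (s := Finset.univ)
    (f := fun i : Fin d => √(M (fun _ => i) (fun _ => i)).re)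
  simp only [Real.sq_sqrt (h0 _), Finset.card_univ, Fintype.card_fin] at h
  refine h.trans ?_
  rw [mul_comm]
  refine mul_le_mul_of_nonneg_right ?_ hd'.le
  have hinj : Injective fun (i : Fin d) (_ : Fin n) => i := fun i j hij => congrFun hij ⟨0, hn⟩
  rw [Matrix.trace, Complex.re_sum, ← Finset.sum_image (f := fun a => (M a a).re)
    (s := Finset.univ) (g := fun (i : Fin d) (_ : Fin n) => i) hinj.injOn]
  exact Finset.sum_le_sum_of_subset_of_nonneg (Finset.subset_univ _) fun a _ _ => h0 a

/-! ### GHZ fidelity of network states -/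

namespace Network

theorem re_trace_ghz_mul_applyLocal_le {n d k : ℕ} (hd : 2 ≤ d) (hk : 1 ≤ k) (hkn : k < n)
    (G : Network (Fin n)) (hG : G.IsKNetwork k) (D : Finset (Fin n) → Fin n → ℕ)
    {γ : ∀ e : G.edges, Matrix (G.SourceIdx D e) (G.SourceIdx D e) ℂ} (hγ : ∀ e, IsState (γ e))
    (C : ∀ v, Channel (G.NodeIdx D v) (Fin d)) :
    (ghz n d * applyLocal C (G.sourceProduct D γ)).trace.re ≤ 1 - 1 / ((k + 1 : ℕ) : ℝ) := by
  have hd' : (0 : ℝ) < d := by exact_mod_cast (by omega : 0 < d)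
  have hstate := G.sourceProduct_isState D hγ
  have hpsd := applyLocal_posSemidef C hstate.posSemidef
  have htr := applyLocal_trace C (G.sourceProduct D γ)
  have hF := re_trace_ghz_mul_le hpsd
  obtain ⟨P, hP⟩ : ∃ P : (Fin n → Fin d) → ℝ,
      ∀ a, applyLocal C (G.sourceProduct D γ) a a = P a :=
    ⟨_, fun a => Complex.eq_re_of_ofReal_le (r := 0) (by simpa using hpsd.diag_nonneg)⟩
  have hP0 : ∀ a, 0 ≤ P a := fun a => Complex.zero_le_real.1 (hP a ▸ hpsd.diag_nonneg)
  have hP1 : ∑ a, P a = 1 := by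
    rw [hstate.trace_eq_one, Matrix.trace] at htr
    simp only [Matrix.diag_apply, hP] at htr
    exact_mod_cast htr
  simp only [hP, Complex.ofReal_re] at hF
  refine hF.trans ((div_le_iff₀' hd').2 ?_)
  let ι : Fin (k + 1) → Fin n := Fin.castLE hkn
  have hι : Injective ι := Fin.castLE_injective hkn
  let A : Fin (k + 1) → (Fin n → Fin d) → Fin d := fun u a => a (ι u)
  -- Agreement of all `n` nodes implies agreement of the chosen `k + 1`, so only these matter from
  -- here on.
  have hQ : ∀ i, P (fun _ => i) ≤ ∑ a, (if ∀ u, A u a = i then 1 else 0) * P a := fun i => by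
    refine le_trans (le_of_eq ?_) (Finset.single_le_sum (f := fun a =>
      (if ∀ u, A u a = i then 1 else 0) * P a)
      (fun a _ => mul_nonneg (by split_ifs <;> norm_num) (hP0 a)) (Finset.mem_univ fun _ => i))
    simp [A]
  have hQs : (∑ i, √(P fun _ => i)) ^ 2 ≤
      (∑ i, √(∑ a, (if ∀ u, A u a = i then 1 else 0) * P a)) ^ 2 :=
    pow_le_pow_left₀ (Finset.sum_nonneg fun i _ => Real.sqrt_nonneg _)
      (Finset.sum_le_sum fun i _ => Real.sqrt_le_sqrt (hQ i)) 2
  refine hQs.trans ?_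
  -- For `k = 1` the two ends are also neighbours, so they are independent in `P` itself;
  -- Cauchy–Schwarz bounds the sum by `1 ≤ d / 2`.
  rcases hk.eq_or_lt with rfl | hk2
  · obtain ⟨P', -, -, hc, hind⟩ := G.exists_inflation D hk hG C hγ P hP hι
    set p : Fin 2 → Fin d → ℝ := fun u i => ∑ a, (if A u a = i then 1 else 0) * P a with hp
    have hp0 : ∀ u i, 0 ≤ p u i := fun u i => Finset.sum_nonneg fun a _ =>
      mul_nonneg (by split_ifs <;> norm_num) (hP0 a)
    have hps : ∀ u, ∑ i, p u i = 1 := fun u => by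
      simp only [hp]
      rw [Finset.sum_comm]
      simp [hP1]
    have hQp : ∀ i, ∑ a, (if ∀ u, A u a = i then 1 else 0) * P a = p 0 i * p 1 i := fun i => by
      have h1 := hc 0 (fun b => if b = i then 1 else 0) (fun b => if b = i then 1 else 0)
      have h2 := hind (fun b => if b = i then 1 else 0) (fun b => if b = i then 1 else 0)
      refine Eq.trans ?_ (h1.symm.trans h2)
      refine Finset.sum_congr rfl fun a _ => ?_
      congr 1
      have : (∀ u, A u a = i) ↔ a (ι 0) = i ∧ a (ι 1) = i := Fin.forall_fin_two
      by_cases h0 : a (ι 0) = i <;> by_cases h1 : a (ι 1) = i <;> simp [this, h0, h1]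
    simp only [hQp, Real.sqrt_mul (hp0 _ _)]
    have hcs := Finset.sum_mul_sq_le_sq_mul_sq Finset.univ (fun i => √(p 0 i)) fun i => √(p 1 i)
    simp only [Real.sq_sqrt (hp0 _ _), hps] at hcs
    have : (2 : ℝ) ≤ d := by exact_mod_cast hd
    norm_num
    linarith
  · refine sq_sum_sqrt_le_of_chain hd hk2 hP0 hP1 A fun π => ?_
    obtain ⟨P', hP'0, hP'1, hc, hind⟩ := G.exists_inflation D hk hG C hγ P hP
      (t := ι ∘ π) (hι.comp π.injective)
    have e1 : ∑ i, (∑ a, (if A (π 0) a = i then 1 else 0) * P a) *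
          (∑ a, (if A (π (Fin.last k)) a = i then 1 else 0) * P a) =
        ∑ a, (if A (π 0) a = A (π (Fin.last k)) a then 1 else 0) * P' a := by
      have h1 := fun i : Fin d => hind (fun b => if b = i then 1 else 0)
        (fun b => if b = i then 1 else 0)
      refine (Finset.sum_congr rfl fun i _ => (h1 i).symm).trans ?_
      rw [Finset.sum_comm]
      refine Finset.sum_congr rfl fun a _ => ?_
      rw [← Finset.sum_mul]
      congr 1
      simp [A, eq_comm]
    have e2 : ∀ j : Fin k, ∑ a, (if A (π j.castSucc) a = A (π j.succ) a then 0 else 1) * P a =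
        ∑ a, (if A (π j.castSucc) a = A (π j.succ) a then 0 else 1) * P' a := fun j => by
      have h1 := fun i : Fin d => hc j (fun b => if b = i then 1 else 0)
        (fun b => if b = i then 1 else 0)
      have h2 := Finset.sum_congr rfl fun i (_ : i ∈ Finset.univ) => h1 i
      have h3 : ∀ R : (Fin n → Fin d) → ℝ, ∑ a, R a = 1 →
          ∑ a, (if A (π j.castSucc) a = A (π j.succ) a then 0 else 1) * R a =
          1 - ∑ a, ∑ i, ((if a ((ι ∘ π) j.castSucc) = i then 1 else 0) *
            (if a ((ι ∘ π) j.succ) = i then 1 else 0)) * R a := fun R hR => by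
        rw [eq_sub_iff_add_eq, ← Finset.sum_add_distrib]
        refine Eq.trans (Finset.sum_congr rfl fun a _ => ?_) hR
        rw [← Finset.sum_mul, ← add_mul]
        simp only [A, comp_apply, mul_ite, mul_one, mul_zero, Finset.sum_ite_eq, Finset.mem_univ,
          if_true]
        by_cases h : a (ι (π j.castSucc)) = a (ι (π j.succ))
        · simp [h]
        · simp [h]
      rw [h3 P hP1, h3 P' hP'1]
      exact congrArg _ (Finset.sum_comm.trans (h2.symm.trans Finset.sum_comm))
    rw [e1, Finset.sum_congr rfl fun j _ => e2 j, Finset.sum_comm, ← Finset.sum_add_distrib]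
    refine hP'1.ge.trans ?_
    refine Finset.sum_le_sum fun a _ => ?_
    rw [← Finset.sum_mul, ← add_mul]
    refine le_mul_of_one_le_left (hP'0 a) ?_
    -- The chain inequality holds outcome by outcome: if all neighbours agree then so do the ends,
    -- and otherwise some disagreement term equals 1.
    by_cases hall : ∀ j : Fin k, A (π j.castSucc) a = A (π j.succ) a
    · have : ∀ j : Fin (k + 1), A (π 0) a = A (π j) a := fun j => by
        induction j using Fin.induction with
        | zero => rfl
        | succ j ih => exact ih.trans (hall j)
      rw [if_pos (this _)]
      exact le_add_of_nonneg_right (Finset.sum_nonneg fun j _ => by split_ifs <;> norm_num)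
    · push Not at hall
      obtain ⟨j, hj⟩ := hall
      have h1 := Finset.single_le_sum (f := fun j : Fin k =>
        if A (π j.castSucc) a = A (π j.succ) a then (0 : ℝ) else 1)
        (fun j _ => by split_ifs <;> norm_num) (Finset.mem_univ j)
      simp only [if_neg hj] at h1
      exact le_add_of_nonneg_of_le (by split_ifs <;> norm_num) h1

theorem re_trace_ghz_mul_and_trace_of_mem_preparable {n d k : ℕ} (hd : 2 ≤ d) (hk : 1 ≤ k)
    (hkn : k < n) {G : Network (Fin n)} (hG : G.IsKNetwork k)
    {σ : Matrix (Fin n → Fin d) (Fin n → Fin d) ℂ}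
    (hσ : σ ∈ G.preparable fun _ : Fin n => Fin d) :
    (ghz n d * σ).trace.re ≤ 1 - 1 / ((k + 1 : ℕ) : ℝ) ∧ σ.trace = 1 := by
  obtain ⟨D, γ, Λ, hγ, rfl⟩ := hσ
  constructor
  · rw [LOSR.apply, Finset.mul_sum, Matrix.trace_sum, Complex.re_sum]
    simp only [Matrix.mul_smul, Matrix.trace_smul, smul_eq_mul, Complex.re_ofReal_mul]
    refine (Finset.sum_le_sum fun l _ => mul_le_mul_of_nonneg_left
      (re_trace_ghz_mul_applyLocal_le hd hk hkn G hG D hγ (Λ.chan l)) (Λ.prob_nonneg l)).trans ?_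
    rw [← Finset.sum_mul, Λ.prob_sum, one_mul]
  · rw [LOSR.apply, Matrix.trace_sum]
    simp only [Matrix.trace_smul, applyLocal_trace, (G.sourceProduct_isState D hγ).trace_eq_one,
      smul_eq_mul, mul_one]
    exact_mod_cast Λ.prob_sum

theorem re_trace_ghz_mul_and_trace_of_mem_freeStates {n d k : ℕ} (hd : 2 ≤ d) (hk : 1 ≤ k)
    (hkn : k < n) {G : Network (Fin n)} (hG : G.IsKNetwork k)
    {σ : Matrix (Fin n → Fin d) (Fin n → Fin d) ℂ}
    (hσ : σ ∈ G.freeStates fun _ : Fin n => Fin d) :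
    (ghz n d * σ).trace.re ≤ 1 - 1 / ((k + 1 : ℕ) : ℝ) ∧ σ.trace = 1 := by
  have hclosed : IsClosed {σ : Matrix (Fin n → Fin d) (Fin n → Fin d) ℂ |
      (ghz n d * σ).trace.re ≤ 1 - 1 / ((k + 1 : ℕ) : ℝ) ∧ σ.trace = 1} := by
    rw [Set.ofPred_and]
    refine (isClosed_le ?_ continuous_const).inter (isClosed_eq ?_ continuous_const)
    · exact Complex.continuous_re.comp (continuous_const.matrix_mul continuous_id).matrix_trace
    · exact continuous_id.matrix_trace
  exact closure_minimal (fun τ hτ =>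
    re_trace_ghz_mul_and_trace_of_mem_preparable hd hk hkn hG hτ) hclosed hσ

/-- The channel from a trivial system that prepares the basis state `b`. -/
def prepareChannel {α β : Type*} [Fintype α] [DecidableEq α] [Unique α] [Fintype β]
    [DecidableEq β] (b : β) : Channel α β where
  rank := 1
  kraus _ := Matrix.of fun b' _ => if b' = b then 1 else 0
  trace_preserving := by
    ext x y
    obtain rfl := Subsingleton.elim x y
    simp [Matrix.mul_apply]

theorem preparable_nonempty {V : Type*} [Fintype V] [DecidableEq V] (G : Network V)
    {β : V → Type*} [∀ v, Fintype (β v)] [∀ v, DecidableEq (β v)] (b : ∀ v, β v) :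
    (G.preparable β).Nonempty := by
  let D : Finset V → V → ℕ := fun _ _ => 1
  refine ⟨_, D, fun _ => 1,
    { size := 1
      prob := fun _ => 1
      prob_nonneg := fun _ => zero_le_one
      prob_sum := by simp
      chan := fun _ v => prepareChannel (b v) }, fun e => ⟨Matrix.PosSemidef.one, ?_⟩, rfl⟩
  rw [Matrix.trace_one]
  simp [D]

end Network

/-! ### The GHZ state and the witness -/

theorem ghz_apply (n d : ℕ) (a b : Fin n → Fin d) :
    ghz n d a b = (1 / (d : ℂ)) * ((∑ i : Fin d, if (fun _ => i) = a then 1 else 0) *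
      ∑ j : Fin d, if (fun _ => j) = b then 1 else 0) := by
  rw [ghz_eq_sum_single, Finset.sum_mul_sum]
  simp only [Matrix.smul_apply, Matrix.sum_apply, Matrix.single_apply, smul_eq_mul]
  congr 1
  refine Finset.sum_congr rfl fun i _ => Finset.sum_congr rfl fun j _ => ?_
  rw [ite_and, ite_mul, one_mul, zero_mul]

theorem ghz_apply_const {n d : ℕ} (hn : 0 < n) (i j : Fin d) :
    ghz n d (fun _ => i) (fun _ => j) = 1 / (d : ℂ) := by
  have h : ∀ i j : Fin d, (fun _ : Fin n => i) = (fun _ => j) ↔ i = j := fun i j =>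
    ⟨fun h => congrFun h ⟨0, hn⟩, fun h => h ▸ rfl⟩
  simp [ghz_apply, h]

theorem ghz_isState {n d : ℕ} (hn : 0 < n) (hd : 0 < d) : IsState (ghz n d) where
  posSemidef := by
    have : ghz n d = (1 / (d : ℂ)) • Matrix.vecMulVec
        (fun a : Fin n → Fin d => ∑ i : Fin d, if (fun _ => i) = a then (1 : ℂ) else 0)
        (star fun a : Fin n → Fin d => ∑ i : Fin d, if (fun _ => i) = a then (1 : ℂ) else 0) := by
      ext a b
      rw [ghz_apply]
      simp [Matrix.vecMulVec_apply]
    rw [this]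
    refine (Matrix.posSemidef_vecMulVec_self_star _).smul ?_
    rw [one_div]
    exact inv_nonneg.2 (Nat.cast_nonneg _)
  trace_eq_one := by
    have hd' : (d : ℂ) ≠ 0 := by exact_mod_cast hd.ne'
    have h := trace_ghz_mul (n := n) (d := d) 1
    have hc : ∀ i j : Fin d, (fun _ : Fin n => i) = (fun _ => j) ↔ i = j := fun i j =>
      ⟨fun h => congrFun h ⟨0, hn⟩, fun h => h ▸ rfl⟩
    rw [mul_one] at h
    rw [h]
    simp [Matrix.one_apply, hc, hd']

theorem trace_ghz_mul_ghz {n d : ℕ} (hn : 0 < n) (hd : 0 < d) :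
    (ghz n d * ghz n d).trace = 1 := by
  have hd' : (d : ℂ) ≠ 0 := by exact_mod_cast hd.ne'
  rw [trace_ghz_mul]
  simp only [ghz_apply_const hn]
  simp [hd']

theorem witnessBound_eq {n d : ℕ} (k : ℕ) {ρ : Matrix (Fin n → Fin d) (Fin n → Fin d) ℂ}
    (hρ : ρ.trace = 1) :
    witnessBound k ρ = max 0 (((k : ℝ) + 1) * (ghz n d * ρ).trace.re - k) := by
  have : (witness n d k * ρ).trace = ((k : ℝ) : ℂ) - ((k + 1 : ℝ) : ℂ) * (ghz n d * ρ).trace := by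
    rw [witness, Matrix.sub_mul, Matrix.smul_mul, Matrix.smul_mul, Matrix.one_mul, Matrix.trace_sub,
      Matrix.trace_smul, Matrix.trace_smul, hρ]
    simp
  rw [witnessBound, this, Complex.sub_re, Complex.re_ofReal_mul, Complex.ofReal_re, neg_sub]

end QNet

theorem mainTheorem6 (n d k : ℕ) (hd : 2 ≤ d) (hk : 1 ≤ k) (hkn : k < n)
    (G : QNet.Network (Fin n)) (hG : G.IsKNetwork k) :
    (∀ ρ : Matrix (Fin n → Fin d) (Fin n → Fin d) ℂ, QNet.IsState ρ →
      QNet.witnessBound k ρ ≤ G.weight ρ) ∧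
    QNet.witnessBound k (QNet.ghz n d) = 1 ∧
    G.weight (QNet.ghz n d) = QNet.witnessBound k (QNet.ghz n d) := by
  have hn : 0 < n := by omega
  have hd0 : 0 < d := by omega
  obtain ⟨σ₀, hσ₀⟩ := G.preparable_nonempty (β := fun _ => Fin d) fun _ => ⟨0, hd0⟩
  -- At `p = 1` the subtracted term vanishes, so any free state will do.
  have hone : ∀ ρ : Matrix (Fin n → Fin d) (Fin n → Fin d) ℂ, QNet.IsState ρ →
      (1 : ℝ) ∈ {p : ℝ | ∃ σ ∈ G.freeStates fun _ => Fin d,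
        (ρ - ((1 - p : ℝ) : ℂ) • σ).PosSemidef} := fun ρ hρ =>
    ⟨σ₀, subset_closure hσ₀, by simpa using hρ.posSemidef⟩
  have hbound : ∀ ρ : Matrix (Fin n → Fin d) (Fin n → Fin d) ℂ, QNet.IsState ρ →
      ∀ p ∈ {p : ℝ | ∃ σ ∈ G.freeStates fun _ => Fin d,
        (ρ - ((1 - p : ℝ) : ℂ) • σ).PosSemidef}, QNet.witnessBound k ρ ≤ p := by
    rintro ρ hρ p ⟨σ, hσ, hM⟩
    obtain ⟨hσF, hσ1⟩ :=
      QNet.Network.re_trace_ghz_mul_and_trace_of_mem_freeStates hd hk hkn hG hσ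
    have hρF := QNet.re_trace_ghz_mul_le_re_trace hn hd0 hρ.posSemidef
    have hMF := QNet.re_trace_ghz_mul_le_re_trace hn hd0 hM
    have hM0 := (Complex.nonneg_iff.1 hM.trace_nonneg).1
    have hMtr : (ρ - ((1 - p : ℝ) : ℂ) • σ).trace.re = p := by
      rw [Matrix.trace_sub, Matrix.trace_smul, hσ1, hρ.trace_eq_one]
      simp
    rw [hMtr] at hMF hM0
    rw [hρ.trace_eq_one, Complex.one_re] at hρF
    rw [Matrix.mul_sub, Matrix.mul_smul, Matrix.trace_sub, Matrix.trace_smul, smul_eq_mul,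
      Complex.sub_re, Complex.re_ofReal_mul] at hMF
    rw [QNet.witnessBound_eq k hρ.trace_eq_one]
    refine max_le hM0 ?_
    have hk1 : (0 : ℝ) < (k : ℝ) + 1 := by positivity
    -- For `p ≥ 1` the coefficient `1 - p` has the wrong sign for the fidelity bound, but `tr (GHZ
    -- ρ) ≤ 1` alone gives a witness value of at most `1 ≤ p`.
    rcases le_total p 1 with hp | hp
    · have h1 := mul_le_mul_of_nonneg_left hσF (sub_nonneg.2 hp)
      have h2 : (QNet.ghz n d * ρ).trace.re ≤ p + (1 - p) * (1 - 1 / ((k + 1 : ℕ) : ℝ)) := by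
        linarith
      have h3 := mul_le_mul_of_nonneg_left h2 hk1.le
      have h4 : ((k : ℝ) + 1) * (p + (1 - p) * (1 - 1 / ((k + 1 : ℕ) : ℝ))) = k + p := by
        push_cast
        field_simp
        ring
      linarith
    · nlinarith
  have hghz := QNet.ghz_isState hn hd0
  have hw : QNet.witnessBound k (QNet.ghz n d) = 1 := by
    rw [QNet.witnessBound_eq k hghz.trace_eq_one, QNet.trace_ghz_mul_ghz hn hd0]
    simp
  have hmain : ∀ ρ : Matrix (Fin n → Fin d) (Fin n → Fin d) ℂ, QNet.IsState ρ →
      QNet.witnessBound k ρ ≤ G.weight ρ := fun ρ hρ =>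
    le_csInf ⟨1, hone ρ hρ⟩ (hbound ρ hρ)
  refine ⟨hmain, hw, le_antisymm ?_ (hmain _ hghz)⟩
  rw [hw]
  exact csInf_le ⟨_, hbound _ hghz⟩ (hone _ hghz)
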